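/- Let $T^2=\mathbb R/\mathbb Z\times\mathbb R/\mathbb Z$, let $\tilde f\colon T^2\to T^2$ be the automorphism $\tilde f(x,y)=(2x+y,x+y)$, let $S=T^2/{\sim}$ be the quotient by the relation $p\sim -p$ with canonical projection $\pi\colon T^2\to S$, and let $f\colon S\to S$ be the homeomorphism defined by $f(\pi(p))=\pi(\tilde f(p))$. Then $S$ is homeomorphic to the two-dimensional sphere, and for every metric on $S$ inducing the quotient topology the following hold. (a) For every $\varepsilon>0$ there is a Cantor set $C\subset S$ (a subspace homeomorphic to the middle-thirds Cantor set) such that $\operatorname{diam} f^n(C)\le\varepsilon$ for all $n\in\mathbb Z$. (b) For every integer $N\ge 1$, $f$ is not $N$-expansive; that is, there is no $\delta>0$ such that every set $A\subset S$ with $\operatorname{diam} f^n(A)\le\delta$ for all $n\in\mathbb Z$ has at most $N$ points. (c) $f$ is cw2-expansive; that is, there is $\delta>0$ such that, whenever $A,B\subset S$ are non-empty compact connected sets with $\operatorname{diam} f^n(A)\le\delta$ for all integers $n\ge 0$ and $\operatorname{diam} f^n(B)\le\delta$ for all integers $n\le 0$, the set $A\cap B$ has at most two points. -/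

import Mathlib

namespace CwExpansive

/-! ### Variants of expansivity for homeomorphisms of compact metric spaces -/

section Expansivity

/-- Non-empty subcontinua of diameter at most `δ` (a continuum is a compact connected set). -/
def SmallContinua (X : Type*) [MetricSpace X] (δ : ℝ) : Set (Set X) :=
  {A | IsCompact A ∧ IsConnected A ∧ Metric.diam A ≤ δ}

/-- `δ`-stable continua: all iterates `f^n(A)` with `n ≥ 0` are continua of diameter at most `δ`. -/
def StableContinua {X : Type*} [MetricSpace X] (f : X ≃ₜ X) (δ : ℝ) : Set (Set X) :=
  {A | ∀ n : ℤ, 0 ≤ n → (f ^ n) '' A ∈ SmallContinua X δ}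

/-- `δ`-unstable continua: all iterates `f^n(A)` with `n ≤ 0` are continua of diameter
at most `δ`. -/
def UnstableContinua {X : Type*} [MetricSpace X] (f : X ≃ₜ X) (δ : ℝ) : Set (Set X) :=
  {A | ∀ n : ℤ, n ≤ 0 → (f ^ n) '' A ∈ SmallContinua X δ}

/-- `f` is cwN-expansive: for some `δ > 0` each `δ`-stable continuum meets each `δ`-unstable
continuum in at most `N` points. -/
def IsCwNExpansive {X : Type*} [MetricSpace X] [CompactSpace X] (N : ℕ) (f : X ≃ₜ X) : Prop :=
  ∃ δ : ℝ, 0 < δ ∧ ∀ A ∈ StableContinua f δ, ∀ B ∈ UnstableContinua f δ,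
    (A ∩ B).encard ≤ N

/-- `f` is N-expansive: for some `δ > 0` every set all of whose iterates `f^n(A)`, `n ∈ ℤ`,
have diameter at most `δ` has at most `N` points. -/
def IsNExpansive {X : Type*} [MetricSpace X] [CompactSpace X] (N : ℕ) (f : X ≃ₜ X) : Prop :=
  ∃ δ : ℝ, 0 < δ ∧ ∀ A : Set X, (∀ n : ℤ, Metric.diam ((f ^ n) '' A) ≤ δ) → A.encard ≤ N

/-- A Cantor set: a subspace homeomorphic to the middle-thirds Cantor set. -/
def IsCantorSet {X : Type*} [TopologicalSpace X] (C : Set X) : Prop :=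
  Nonempty (C ≃ₜ cantorSet)

end Expansivity

/-! ### The map of the sphere -/

section SphereMap

/-- The torus `T² = ℝ/ℤ × ℝ/ℤ`. -/
abbrev Torus : Type := UnitAddCircle × UnitAddCircle

/-- The hyperbolic torus automorphism `(x, y) ↦ (2x + y, x + y)`. -/
def torusMap : Torus ≃ₜ Torus where
  toFun p := (2 • p.1 + p.2, p.1 + p.2)
  invFun p := (p.1 - p.2, 2 • p.2 - p.1)
  left_inv p := by ext <;> dsimp only <;> abel
  right_inv p := by ext <;> dsimp only <;> abel
  continuous_toFun := by fun_prop
  continuous_invFun := by fun_prop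

/-- The equivalence relation on the torus that identifies `p` with `-p`. -/
def negSetoid : Setoid Torus where
  r p q := q = p ∨ q = -p
  iseqv :=
    { refl := fun _ => Or.inl rfl
      symm := by
        rintro p q (rfl | rfl)
        · exact Or.inl rfl
        · exact Or.inr (neg_neg p).symm
      trans := by
        rintro p q r (rfl | rfl) (rfl | rfl)
        · exact Or.inl rfl
        · exact Or.inr rfl
        · exact Or.inr rfl
        · exact Or.inl (neg_neg p) }

/-- The quotient `T²/(p ∼ -p)`, with the quotient topology. -/
abbrev TorusQuotient : Type := Quotient negSetoid

/-- The canonical projection from the torus to the quotient. -/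
def proj (p : Torus) : TorusQuotient := Quotient.mk negSetoid p

theorem torusMap_neg (p : Torus) : torusMap (-p) = -torusMap p := by
  ext <;> simp [torusMap] <;> abel

theorem torusMap_symm_neg (p : Torus) : torusMap.symm (-p) = -torusMap.symm p := by
  rw [Homeomorph.symm_apply_eq, torusMap_neg, Homeomorph.apply_symm_apply]

theorem torusMap_rel (p q : Torus) (h : negSetoid p q) :
    negSetoid (torusMap p) (torusMap q) := by
  rcases h with rfl | rfl
  · exact Or.inl rfl
  · exact Or.inr (torusMap_neg p)

theorem torusMap_symm_rel (p q : Torus) (h : negSetoid p q) :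
    negSetoid (torusMap.symm p) (torusMap.symm q) := by
  rcases h with rfl | rfl
  · exact Or.inl rfl
  · exact Or.inr (torusMap_symm_neg p)

/-- The homeomorphism of the quotient induced by `torusMap`. -/
def quotientMap : TorusQuotient ≃ₜ TorusQuotient where
  toFun := Quotient.map torusMap torusMap_rel
  invFun := Quotient.map torusMap.symm torusMap_symm_rel
  left_inv := by
    rintro ⟨p⟩
    exact congrArg proj (torusMap.symm_apply_apply p)
  right_inv := by
    rintro ⟨p⟩
    exact congrArg proj (torusMap.apply_symm_apply p)
  continuous_toFun := torusMap.continuous.quotient_map' torusMap_rel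
  continuous_invFun := torusMap.symm.continuous.quotient_map' torusMap_symm_rel

/-- The defining property `f(π(p)) = π(f̃(p))`. -/
theorem quotientMap_proj (p : Torus) : quotientMap (proj p) = proj (torusMap p) := rfl

/-- The homeomorphism of `X` obtained from the map of `T²/(p ∼ -p)` when the quotient is identified
with `X` by a homeomorphism `φ`. -/
def mapOn {X : Type*} [TopologicalSpace X] (φ : TorusQuotient ≃ₜ X) : X ≃ₜ X :=
  (φ.symm.trans quotientMap).trans φ

theorem mapOn_proj {X : Type*} [TopologicalSpace X] (φ : TorusQuotient ≃ₜ X) (p : Torus) :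
    mapOn φ (φ (proj p)) = φ (proj (torusMap p)) := by
  simp [mapOn, quotientMap_proj]

end SphereMap

end CwExpansive

namespace CwExpansive

/-! ### The quotient of the torus is a sphere -/

/-! The sphere comes from an even map of the torus into space with fibres `{p, -p}`. Its image is
the part of z² = (1 - x²)(1 - y²) with |x|, |y| ≤ 1, which every ray from the origin meets exactly
once, so radial projection yields a continuous bijection from a compact space to the sphere.

The dynamics rests on hyperbolicity upstairs and on the sign being invisible downstairs. The torus
map is expansive (`eq_zero_of_forall_norm_zpow_le`). For (c), small continua are covered by small
connected sets upstairs (`exists_isPreconnected_lift`, `norm_sub_le_of_isPreconnected`). Differences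
inside the lift of a stable continuum stay small in the future, those inside the lift of an unstable
one in the past, so a difference common to both, up to sign, is zero. Points of the intersection
have lifts that are equal or opposite, and each case accounts for at most one point.

For (a), follow a periodic point p near 0, switching between p and -p at chosen returns. The jumps
are small, and a bounded solution of a linear recursion corrects them to true orbits
(`exists_orbit_near_signed_orbit`). Downstairs all of them follow the orbit of the image of p, yet
expansivity applied to 2p shows that different sign choices give different points. The closed set of
followers is uncountable, so it contains a Cantor set; since that is infinite, (b) follows. -/

theorem re_sq_add_im_sq (z : Circle) : (z : ℂ).re ^ 2 + (z : ℂ).im ^ 2 = 1 := by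
  have h := Circle.normSq_coe z
  rw [Complex.normSq_apply] at h
  linarith

theorem exists_toCircle_eq {a s : ℝ} (h : a ^ 2 + s ^ 2 = 1) :
    ∃ x : UnitAddCircle, (x.toCircle : ℂ).re = a ∧ (x.toCircle : ℂ).im = s := by
  have hz : (⟨a, s⟩ : ℂ) ∈ Submonoid.unitSphere ℂ := by
    refine mem_sphere_zero_iff_norm.2 ?_
    rw [← sq_eq_sq₀ (norm_nonneg _) zero_le_one, ← Complex.normSq_eq_norm_sq, Complex.normSq_mk]
    linarith
  obtain ⟨x, hx⟩ := (AddCircle.homeomorphCircle (T := (1 : ℝ)) one_ne_zero).surjective ⟨_, hz⟩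
  rw [AddCircle.homeomorphCircle_apply] at hx
  exact ⟨x, by rw [hx], by rw [hx]⟩

theorem toCircle_eq_or_eq_neg {x y : UnitAddCircle}
    (h : (x.toCircle : ℂ).re = (y.toCircle : ℂ).re) :
    ((x.toCircle : ℂ).im = (y.toCircle : ℂ).im ∧ x = y) ∨
      ((x.toCircle : ℂ).im = -(y.toCircle : ℂ).im ∧ x = -y) := by
  have hinj := AddCircle.injective_toCircle (T := (1 : ℝ)) one_ne_zero
  have h1 := re_sq_add_im_sq x.toCircle
  have h2 := re_sq_add_im_sq y.toCircle
  rw [h] at h1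
  rcases sq_eq_sq_iff_eq_or_eq_neg.1 (by linarith :
    (x.toCircle : ℂ).im ^ 2 = (y.toCircle : ℂ).im ^ 2) with h3 | h3
  · exact Or.inl ⟨h3, hinj (Circle.ext (Complex.ext h h3))⟩
  · refine Or.inr ⟨h3, hinj (Circle.ext ?_)⟩
    rw [AddCircle.toCircle_neg, Circle.coe_inv_eq_conj]
    exact Complex.ext (by simpa using h) (by simpa using h3)

/-- The even map `(x, y) ↦ (cos x, cos y, sin x sin y)` from the torus to space, whose image is
a star-shaped pillow. -/
noncomputable def pillow (p : Torus) : EuclideanSpace ℝ (Fin 3) :=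
  !₂[(p.1.toCircle : ℂ).re, (p.2.toCircle : ℂ).re,
    (p.1.toCircle : ℂ).im * (p.2.toCircle : ℂ).im]

theorem continuous_pillow : Continuous pillow := by
  have h : Continuous (AddCircle.toCircle (T := (1 : ℝ))) := AddCircle.continuous_toCircle
  refine (PiLp.continuous_toLp 2 _).comp (continuous_pi fun i => ?_)
  fin_cases i <;> dsimp <;> fun_prop

theorem pillow_neg (p : Torus) : pillow (-p) = pillow p := by
  simp [pillow, AddCircle.toCircle_neg]

theorem pillow_equation (p : Torus) :
    pillow p 2 ^ 2 = (1 - pillow p 0 ^ 2) * (1 - pillow p 1 ^ 2) ∧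
      pillow p 0 ^ 2 ≤ 1 ∧ pillow p 1 ^ 2 ≤ 1 := by
  have h1 := re_sq_add_im_sq p.1.toCircle
  have h2 := re_sq_add_im_sq p.2.toCircle
  simp only [pillow, PiLp.toLp_apply, Matrix.cons_val]
  refine ⟨?_, by nlinarith, by nlinarith⟩
  rw [mul_pow, eq_sub_of_add_eq' h1, eq_sub_of_add_eq' h2]

theorem exists_pillow_eq {v : EuclideanSpace ℝ (Fin 3)}
    (h : v 2 ^ 2 = (1 - v 0 ^ 2) * (1 - v 1 ^ 2)) (h0 : v 0 ^ 2 ≤ 1) (h1 : v 1 ^ 2 ≤ 1) :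
    ∃ p, pillow p = v := by
  obtain ⟨x, hx, hx'⟩ := exists_toCircle_eq (a := v 0) (s := √(1 - v 0 ^ 2))
    (by rw [Real.sq_sqrt (by linarith)]; ring)
  -- The first sine was chosen nonnegative, so the second one carries the sign of `v 2`.
  have key : ∃ s : ℝ, v 1 ^ 2 + s ^ 2 = 1 ∧ √(1 - v 0 ^ 2) * s = v 2 := by
    have hs : (√(1 - v 0 ^ 2) * √(1 - v 1 ^ 2)) ^ 2 = v 2 ^ 2 := by
      rw [mul_pow, Real.sq_sqrt (by linarith), Real.sq_sqrt (by linarith), h]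
    rcases sq_eq_sq_iff_eq_or_eq_neg.1 hs with hs | hs
    · exact ⟨_, by rw [Real.sq_sqrt (by linarith)]; ring, hs⟩
    · exact ⟨-√(1 - v 1 ^ 2), by rw [neg_sq, Real.sq_sqrt (by linarith)]; ring, by linarith⟩
  obtain ⟨s, hs, hs'⟩ := key
  obtain ⟨y, hy, hy'⟩ := exists_toCircle_eq hs
  refine ⟨(x, y), ?_⟩
  ext i
  fin_cases i <;> simp [pillow, hx, hx', hy, hy', hs']

theorem pillow_injective {p q : Torus} (h : pillow p = pillow q) : q = p ∨ q = -p := by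
  have e0 := congrFun (congrArg WithLp.ofLp h.symm) 0
  have e1 := congrFun (congrArg WithLp.ofLp h.symm) 1
  have e2 := congrFun (congrArg WithLp.ofLp h.symm) 2
  simp only [pillow, Matrix.cons_val] at e0 e1 e2
  have selfneg : ∀ x : UnitAddCircle, (x.toCircle : ℂ).im = 0 → -x = x := by
    intro x hx
    rcases toCircle_eq_or_eq_neg (x := -x) (y := x)
      (by simp [AddCircle.toCircle_neg]) with h | h
    · exact h.2
    · refine AddCircle.injective_toCircle (T := (1 : ℝ)) one_ne_zero (Circle.ext ?_)
      rw [AddCircle.toCircle_neg, Circle.coe_inv_eq_conj]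
      exact Complex.ext (by simp) (by simp [hx])
  rcases toCircle_eq_or_eq_neg e0 with ⟨i0, h0⟩ | ⟨i0, h0⟩ <;>
    rcases toCircle_eq_or_eq_neg e1 with ⟨i1, h1⟩ | ⟨i1, h1⟩
  · exact Or.inl (Prod.ext h0 h1)
  -- With mixed signs the product of sines equals its own negative, so one sine vanishes and that
  -- coordinate is its own negative.
  · rw [i0, i1] at e2
    rcases mul_eq_zero.1 (by linarith : (p.1.toCircle : ℂ).im * (p.2.toCircle : ℂ).im = 0)
      with h | h
    · exact Or.inr (Prod.ext (h0.trans (selfneg _ h).symm) h1)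
    · exact Or.inl (Prod.ext h0 (h1.trans (selfneg _ h)))
  · rw [i0, i1] at e2
    rcases mul_eq_zero.1 (by linarith : (p.1.toCircle : ℂ).im * (p.2.toCircle : ℂ).im = 0)
      with h | h
    · exact Or.inl (Prod.ext (h0.trans (selfneg _ h)) h1)
    · exact Or.inr (Prod.ext h0 (h1.trans (selfneg _ h).symm))
  · exact Or.inr (Prod.ext h0 h1)

/-! ### The pillow is star-shaped about the origin -/

theorem pillow_ne_zero (p : Torus) : pillow p ≠ 0 := by
  intro h
  have := (pillow_equation p).1
  simp [h] at this

/-- Moving outwards along a ray strictly increases z² (positive here) but does not increase (1 -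
x²)(1 - y²) while |x|, |y| ≤ 1. -/
theorem pillow_ray_unique {p q : Torus} {s : ℝ} (hs : 1 ≤ s) (h : pillow q = s • pillow p) :
    s = 1 := by
  obtain ⟨e, a, b⟩ := pillow_equation p
  obtain ⟨e', a', b'⟩ := pillow_equation q
  rw [h] at e' a' b'
  simp only [PiLp.smul_apply, smul_eq_mul, mul_pow] at e' a' b'
  have hs2 : 1 ≤ s ^ 2 := one_le_pow₀ hs
  suffices s ^ 2 = 1 by nlinarith
  by_contra hne
  have hlt : 1 < s ^ 2 := lt_of_le_of_ne hs2 (Ne.symm hne)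
  generalize s ^ 2 = t at *
  have hA' : 0 ≤ pillow p 0 ^ 2 := sq_nonneg _
  have hB' : 0 ≤ pillow p 1 ^ 2 := sq_nonneg _
  generalize pillow p 0 ^ 2 = A at *
  generalize pillow p 1 ^ 2 = B at *
  have hC : 0 ≤ pillow p 2 ^ 2 := sq_nonneg _
  generalize pillow p 2 ^ 2 = C at *
  have hA : A < 1 := by nlinarith
  have hB : B < 1 := by nlinarith
  have hA0 : 0 < (1 - A) * (1 - B) := mul_pos (by linarith) (by linarith)
  have hle : (1 - t * A) * (1 - t * B) ≤ (1 - A) * (1 - B) :=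
    mul_le_mul (by nlinarith) (by nlinarith) (by linarith) (by linarith)
  nlinarith [mul_pos (by linarith : 0 < t - 1) (e ▸ hA0 : 0 < C)]

theorem exists_smul_eq_pillow {v : EuclideanSpace ℝ (Fin 3)} (hv : v ≠ 0) :
    ∃ t : ℝ, 0 < t ∧ ∃ p, pillow p = t • v := by
  let g : ℝ → ℝ := fun t => (1 - t ^ 2 * v 0 ^ 2) * (1 - t ^ 2 * v 1 ^ 2) - t ^ 2 * v 2 ^ 2
  have hg : Continuous g := by fun_prop
  -- Since `g 0 = 1`, a sign change before the ray leaves the column |x|, |y| ≤ 1 gives the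
  -- crossing. `T` is the exit time `m⁻¹` below, or `|v 2|⁻¹` on a vertical ray, which never exits.
  have main : ∀ T : ℝ, 0 ≤ T → T ^ 2 * v 0 ^ 2 ≤ 1 → T ^ 2 * v 1 ^ 2 ≤ 1 → g T ≤ 0 →
      ∃ t : ℝ, 0 < t ∧ ∃ p, pillow p = t • v := by
    intro T hT h0 h1 hgT
    obtain ⟨t, ⟨ht0, htT⟩, ht⟩ := intermediate_value_Icc' hT hg.continuousOn
      (⟨hgT, by simp [g]⟩ : (0 : ℝ) ∈ Set.Icc (g T) (g 0))
    have htne : t ≠ 0 := by rintro rfl; simp [g] at ht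
    have hsq : t ^ 2 ≤ T ^ 2 := by gcongr
    refine ⟨t, lt_of_le_of_ne ht0 htne.symm, exists_pillow_eq ?_ ?_ ?_⟩ <;>
      simp only [PiLp.smul_apply, smul_eq_mul, mul_pow]
    · simp only [g] at ht
      linarith
    · exact (mul_le_mul_of_nonneg_right hsq (sq_nonneg _)).trans h0
    · exact (mul_le_mul_of_nonneg_right hsq (sq_nonneg _)).trans h1
  rcases eq_or_ne (max |v 0| |v 1|) 0 with hm | hm
  · have h0 : v 0 = 0 := abs_eq_zero.1 (le_antisymm (hm ▸ le_max_left _ _) (abs_nonneg _))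
    have h1 : v 1 = 0 := abs_eq_zero.1 (le_antisymm (hm ▸ le_max_right _ _) (abs_nonneg _))
    have h2 : v 2 ≠ 0 := by
      intro h2
      refine hv (PiLp.ext fun i => ?_)
      fin_cases i <;> simp [h0, h1, h2]
    refine main |v 2|⁻¹ (by positivity) (by simp [h0]) (by simp [h1]) ?_
    simp [g, h0, h1, h2]
  · set m := max |v 0| |v 1| with hmdef
    have hmpos : 0 < m := lt_of_le_of_ne ((abs_nonneg _).trans (le_max_left _ _)) hm.symm
    have h0 : v 0 ^ 2 ≤ m ^ 2 := sq_le_sq' (by linarith [neg_abs_le (v 0), le_max_left |v 0| |v 1|])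
      ((le_abs_self _).trans (le_max_left _ _))
    have h1 : v 1 ^ 2 ≤ m ^ 2 := sq_le_sq' (by linarith [neg_abs_le (v 1), le_max_right |v 0| |v 1|])
      ((le_abs_self _).trans (le_max_right _ _))
    have hm1 : m⁻¹ ^ 2 * m ^ 2 = 1 := by field_simp
    refine main m⁻¹ (by positivity) (hm1 ▸ by gcongr) (hm1 ▸ by gcongr) ?_
    have : (1 - m⁻¹ ^ 2 * v 0 ^ 2) * (1 - m⁻¹ ^ 2 * v 1 ^ 2) = 0 := by
      rcases max_choice |v 0| |v 1| with h | h
      · rw [mul_eq_zero]; left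
        rw [← sq_abs (v 0), ← h, hm1, sub_self]
      · rw [mul_eq_zero]; right
        rw [← sq_abs (v 1), ← h, hm1, sub_self]
    simp only [g, this, zero_sub]
    exact neg_nonpos.2 (by positivity)

/-- The radial projection of the pillow to the unit sphere. -/
noncomputable def pillowToSphere (p : Torus) : Metric.sphere (0 : EuclideanSpace ℝ (Fin 3)) 1 :=
  ⟨‖pillow p‖⁻¹ • pillow p, by
    rw [mem_sphere_zero_iff_norm, norm_smul, norm_inv, norm_norm,
      inv_mul_cancel₀ (norm_ne_zero_iff.2 (pillow_ne_zero p))]⟩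

theorem continuous_pillowToSphere : Continuous pillowToSphere :=
  ((continuous_pillow.norm.inv₀ fun p => norm_ne_zero_iff.2 (pillow_ne_zero p)).smul
    continuous_pillow).subtype_mk _

theorem pillowToSphere_injective {p q : Torus} (h : pillowToSphere p = pillowToSphere q) :
    q = p ∨ q = -p := by
  have hp := norm_pos_iff.2 (pillow_ne_zero p)
  have hq := norm_pos_iff.2 (pillow_ne_zero q)
  have h' : ‖pillow p‖⁻¹ • pillow p = ‖pillow q‖⁻¹ • pillow q := congrArg Subtype.val h
  have e1 : pillow q = (‖pillow q‖ * ‖pillow p‖⁻¹) • pillow p := by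
    rw [mul_smul, h', smul_inv_smul₀ hq.ne']
  have e2 : pillow p = (‖pillow p‖ * ‖pillow q‖⁻¹) • pillow q := by
    rw [mul_smul, ← h', smul_inv_smul₀ hp.ne']
  refine pillow_injective ?_
  rcases le_total ‖pillow p‖ ‖pillow q‖ with hle | hle
  · have := pillow_ray_unique (by rwa [← div_eq_mul_inv, one_le_div hp]) e1
    rw [this, one_smul] at e1
    exact e1.symm
  · have := pillow_ray_unique (by rwa [← div_eq_mul_inv, one_le_div hq]) e2
    rw [this, one_smul] at e2
    exact e2

theorem pillowToSphere_surjective : Function.Surjective pillowToSphere := by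
  rintro ⟨v, hv⟩
  have hv1 : ‖v‖ = 1 := mem_sphere_zero_iff_norm.1 hv
  obtain ⟨t, ht, p, hp⟩ := exists_smul_eq_pillow (v := v) (by rintro rfl; simp at hv1)
  refine ⟨p, Subtype.ext ?_⟩
  simp only [pillowToSphere, hp, norm_smul, Real.norm_eq_abs, abs_of_pos ht, hv1, mul_one]
  exact inv_smul_smul₀ ht.ne' v

theorem nonempty_torusQuotient_homeomorph_sphere :
    Nonempty (TorusQuotient ≃ₜ Metric.sphere (0 : EuclideanSpace ℝ (Fin 3)) 1) := by
  let F : TorusQuotient → Metric.sphere (0 : EuclideanSpace ℝ (Fin 3)) 1 :=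
    Quotient.lift pillowToSphere (by
      rintro p q (rfl | rfl)
      · rfl
      · exact Subtype.ext (by simp only [pillowToSphere, pillow_neg]))
  have hF : Continuous F := continuous_pillowToSphere.quotient_lift _
  have hbij : Function.Bijective F := by
    constructor
    · rintro ⟨p⟩ ⟨q⟩ h
      exact Quotient.sound (pillowToSphere_injective h)
    · intro v
      obtain ⟨p, hp⟩ := pillowToSphere_surjective v
      exact ⟨Quotient.mk _ p, hp⟩
  exact ⟨Continuous.homeoOfEquivCompactToT2 (f := Equiv.ofBijective F hbij) hF⟩

/-! ### Orbits of the torus automorphism -/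

/-- Used to recognise sequences given by formulas as orbits, both for the linearity of the powers
and for shadowing. -/
theorem eq_zpow_apply {X : Type*} [TopologicalSpace X] {f : X ≃ₜ X} {x : ℤ → X}
    (h : ∀ n, x (n + 1) = f (x n)) (n : ℤ) : x n = (f ^ n) (x 0) := by
  induction n using Int.induction_on with
  | zero => rfl
  | succ n ih =>
    rw [h, ih, add_comm, zpow_one_add]
    rfl
  | pred n ih =>
    have hn := h (-(n : ℤ) - 1)
    rw [sub_add_cancel, ih] at hn
    rw [← f.symm_apply_eq.2 hn, sub_eq_neg_add, zpow_add, zpow_neg_one]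
    rfl

theorem zpow_add_one_apply {X : Type*} [TopologicalSpace X] (f : X ≃ₜ X) (n : ℤ) (x : X) :
    (f ^ (n + 1)) x = f ((f ^ n) x) := by
  rw [add_comm, zpow_one_add]
  rfl

theorem torusMap_add (p q : Torus) : torusMap (p + q) = torusMap p + torusMap q := by
  ext <;> simp [torusMap] <;> abel

theorem torusMap_zpow_add (n : ℤ) (p q : Torus) :
    (torusMap ^ n) (p + q) = (torusMap ^ n) p + (torusMap ^ n) q :=
  (eq_zpow_apply (x := fun n => (torusMap ^ n) p + (torusMap ^ n) q)
    (fun n => by rw [zpow_add_one_apply, zpow_add_one_apply, torusMap_add]) n).symm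

theorem torusMap_zpow_neg (n : ℤ) (p : Torus) : (torusMap ^ n) (-p) = -(torusMap ^ n) p :=
  (eq_zpow_apply (x := fun n => -(torusMap ^ n) p)
    (fun n => by rw [zpow_add_one_apply, torusMap_neg]) n).symm

theorem torusMap_zpow_sub (n : ℤ) (p q : Torus) :
    (torusMap ^ n) (p - q) = (torusMap ^ n) p - (torusMap ^ n) q := by
  rw [sub_eq_add_neg, torusMap_zpow_add, torusMap_zpow_neg, ← sub_eq_add_neg]

theorem mapOn_zpow_proj {X : Type*} [TopologicalSpace X] (φ : TorusQuotient ≃ₜ X) (n : ℤ)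
    (p : Torus) : (mapOn φ ^ n) (φ (proj p)) = φ (proj ((torusMap ^ n) p)) :=
  (eq_zpow_apply (x := fun n => φ (proj ((torusMap ^ n) p)))
    (fun n => by rw [zpow_add_one_apply, mapOn_proj]) n).symm

/-! ### Real lifts and expansivity of the automorphism -/

theorem exists_coe_eq_abs_eq_norm (x : UnitAddCircle) :
    ∃ r : ℝ, (r : UnitAddCircle) = x ∧ |r| = ‖x‖ := by
  induction x using QuotientAddGroup.induction_on with
  | H r =>
    refine ⟨r - round r, ?_, UnitAddCircle.norm_eq.symm⟩
    have : ((round r : ℝ) : UnitAddCircle) = 0 := AddCircle.coe_eq_zero_iff 1 |>.2 ⟨round r, by simp⟩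
    rw [AddCircle.coe_sub, this, sub_zero]

theorem eq_of_coe_eq_of_abs_sub_lt_one {r s : ℝ} (h : (r : UnitAddCircle) = s)
    (hrs : |r - s| < 1) : r = s := by
  obtain ⟨n, hn⟩ := (AddCircle.coe_eq_zero_iff (1 : ℝ) (x := r - s)).1
    (by rw [AddCircle.coe_sub, h, sub_self])
  rw [zsmul_eq_mul, mul_one] at hn
  rw [← hn, ← Int.cast_abs] at hrs
  have : n = 0 := Int.abs_lt_one_iff.1 (by exact_mod_cast hrs)
  rw [this, Int.cast_zero] at hn
  linarith

theorem norm_coe_le_abs (r : ℝ) : ‖(r : UnitAddCircle)‖ ≤ |r| := by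
  rw [UnitAddCircle.norm_eq]
  simpa using round_le r 0

open Real in
theorem one_lt_goldenRatio_sq : 1 < goldenRatio ^ 2 :=
  one_lt_pow₀ one_lt_goldenRatio two_ne_zero

theorem eq_zero_of_bounded_geometric {μ M : ℝ} (hμ : 1 < μ) {u : ℕ → ℝ}
    (hu : ∀ n, u (n + 1) = μ * u n) (hM : ∀ n, |u n| ≤ M) : u 0 = 0 := by
  have h : ∀ n, u n = μ ^ n * u 0 := by
    intro n
    induction n with
    | zero => simp
    | succ n ih => rw [hu, ih, pow_succ']; ring
  by_contra h0
  obtain ⟨n, hn⟩ := pow_unbounded_of_one_lt (M / |u 0|) hμ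
  rw [div_lt_iff₀ (abs_pos.2 h0)] at hn
  have := hM n
  rw [h, abs_mul, abs_of_pos (pow_pos (zero_lt_one.trans hμ) n)] at this
  linarith

open Real in
/-- The automorphism `(x, y) ↦ (2x + y, x + y)` is expansive with constant `1/8`. -/
theorem eq_zero_of_forall_norm_zpow_le {z : Torus} (h : ∀ n : ℤ, ‖(torusMap ^ n) z‖ ≤ 1 / 8) :
    z = 0 := by
  choose x hx hx' using fun n : ℤ => exists_coe_eq_abs_eq_norm ((torusMap ^ n) z).1
  choose y hy hy' using fun n : ℤ => exists_coe_eq_abs_eq_norm ((torusMap ^ n) z).2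
  have hxb : ∀ n, |x n| ≤ 1 / 8 := fun n => (hx' n).trans_le ((norm_fst_le _).trans (h n))
  have hyb : ∀ n, |y n| ≤ 1 / 8 := fun n => (hy' n).trans_le ((norm_snd_le _).trans (h n))
  have hxs : ∀ n, x (n + 1) = 2 * x n + y n := by
    intro n
    refine eq_of_coe_eq_of_abs_sub_lt_one ?_ ?_
    · rw [hx, zpow_add_one_apply, two_mul, AddCircle.coe_add, AddCircle.coe_add, hx, hy, ← two_nsmul]
      rfl
    -- The two sides differ by at most 4/8 < 1, so the recursion modulo 1 holds in ℝ.
    · have := abs_le.1 (hxb n); have := abs_le.1 (hxb (n + 1)); have := abs_le.1 (hyb n)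
      rw [abs_lt]; constructor <;> linarith
  have hys : ∀ n, y (n + 1) = x n + y n := by
    intro n
    refine eq_of_coe_eq_of_abs_sub_lt_one ?_ ?_
    · rw [hy, zpow_add_one_apply, AddCircle.coe_add, hx, hy]
      rfl
    · have := abs_le.1 (hxb n); have := abs_le.1 (hyb (n + 1)); have := abs_le.1 (hyb n)
      rw [abs_lt]; constructor <;> linarith
  have bound : ∀ (c : ℝ) (n : ℤ), |c * x n + y n| ≤ |c| * (1 / 8) + 1 / 8 := fun c n =>
    (abs_add_le _ _).trans (add_le_add
      ((abs_mul _ _).trans_le (mul_le_mul_of_nonneg_left (hxb n) (abs_nonneg _))) (hyb n))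
  -- The two eigenfunctionals expand by the squared golden ratio, one forwards and the other
  -- backwards in time; bounded, both vanish.
  have hu := eq_zero_of_bounded_geometric one_lt_goldenRatio_sq
    (u := fun n : ℕ => goldenRatio * x n + y n) (fun n => by
      push_cast
      rw [hxs, hys]
      linear_combination (-(goldenRatio * x n) - x n - y n) * goldenRatio_sq)
    (fun n => bound _ _)
  have hs := eq_zero_of_bounded_geometric one_lt_goldenRatio_sq
    (u := fun n : ℕ => goldenConj * x (-n) + y (-n)) (fun n => by
      have e1 := hxs (-((n : ℤ) + 1))
      have e2 := hys (-((n : ℤ) + 1))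
      rw [show -((n : ℤ) + 1) + 1 = -n by ring] at e1 e2
      push_cast
      rw [e1, e2]
      generalize x (-((n : ℤ) + 1)) = X
      generalize y (-((n : ℤ) + 1)) = Y
      have e3 : goldenConj * (2 * X + Y) + (X + Y) = goldenConj ^ 2 * (goldenConj * X + Y) := by
        linear_combination (-(goldenConj * X) - X - Y) * goldenConj_sq
      rw [e3, ← mul_assoc, ← mul_pow, goldenRatio_mul_goldenConj]
      ring)
    (fun n => bound _ _)
  simp only [Nat.cast_zero, neg_zero] at hu hs
  have hne : goldenRatio - goldenConj ≠ 0 := by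
    rw [goldenRatio_sub_goldenConj]; positivity
  have hx0 : x 0 = 0 := (mul_eq_zero.1 (by linarith :
    (goldenRatio - goldenConj) * x 0 = 0)).resolve_left hne
  have hy0 : y 0 = 0 := by rw [hx0] at hu; linarith
  refine Prod.ext ?_ ?_
  · rw [← show ((torusMap ^ (0 : ℤ)) z).1 = z.1 from rfl, ← hx, hx0]; rfl
  · rw [← show ((torusMap ^ (0 : ℤ)) z).2 = z.2 from rfl, ← hy, hy0]; rfl

/-! ### Lifting connected sets, and cw2-expansivity -/

section Lift

variable {X : Type*} [MetricSpace X] (φ : TorusQuotient ≃ₜ X)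

theorem continuous_proj : Continuous proj := continuous_quotient_mk'

theorem proj_eq_iff {p q : Torus} : proj p = proj q ↔ q = p ∨ q = -p :=
  Quotient.eq (r := negSetoid)

/-- By compactness: the distance downstairs is positive on the compact set of pairs where both norms
are at least `η`. -/
theorem exists_norm_sub_or_add_le {η : ℝ} (hη : 0 < η) : ∃ δ : ℝ, 0 < δ ∧ ∀ a b : Torus,
    dist (φ (proj a)) (φ (proj b)) ≤ δ → ‖a - b‖ ≤ η ∨ ‖a + b‖ ≤ η := by
  have hφ : Continuous fun p => φ (proj p) := φ.continuous.comp continuous_proj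
  let K : Set (Torus × Torus) := {ab | η ≤ ‖ab.1 - ab.2‖ ∧ η ≤ ‖ab.1 + ab.2‖}
  have hK : IsClosed K := (isClosed_le (f := fun _ : Torus × Torus => η)
    (g := fun ab => ‖ab.1 - ab.2‖) (by fun_prop) (by fun_prop)).inter
    (isClosed_le (f := fun _ : Torus × Torus => η) (g := fun ab => ‖ab.1 + ab.2‖)
      (by fun_prop) (by fun_prop))
  have hd : Continuous fun ab : Torus × Torus => dist (φ (proj ab.1)) (φ (proj ab.2)) :=
    (hφ.comp continuous_fst).dist (hφ.comp continuous_snd)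
  obtain ⟨δ, hδ, h⟩ := hK.isCompact.exists_forall_le' (a := 0) hd.continuousOn (by
    rintro ⟨a, b⟩ ⟨h1, h2⟩
    refine dist_pos.2 fun h => ?_
    rcases proj_eq_iff.1 (φ.injective h) with h | h <;> dsimp only at h h1 h2
    · rw [h, sub_self, norm_zero] at h1; linarith
    · rw [h, add_neg_cancel, norm_zero] at h2; linarith)
  refine ⟨δ / 2, by positivity, fun a b hab => ?_⟩
  by_contra! hcon
  have := h (a, b) ⟨hcon.1.le, hcon.2.le⟩
  simp only at this
  linarith

/-- A compact connected set in the quotient is covered by a connected set through any prescribed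
preimage of one of its points. -/
theorem exists_isPreconnected_lift {A : Set X} (hA : IsCompact A) (hA' : IsPreconnected A)
    {x : Torus} (hx : φ (proj x) ∈ A) : ∃ L : Set Torus, IsPreconnected L ∧ x ∈ L ∧
      (∀ a ∈ L, φ (proj a) ∈ A) ∧ ∀ y ∈ A, ∃ a ∈ L, φ (proj a) = y := by
  have hφ : Continuous fun p => φ (proj p) := φ.continuous.comp continuous_proj
  have hneg : ∀ p, proj (-p) = proj p := fun p => proj_eq_iff.2 (Or.inr (neg_neg p).symm)
  let K : Set Torus := {p | φ (proj p) ∈ A}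
  have hK : IsClosed K := hA.isClosed.preimage hφ
  have : CompactSpace K := isCompact_iff_compactSpace.1 hK.isCompact
  let x' : K := ⟨x, hx⟩
  let ι : K → K := fun p => ⟨-p.1, by
    change φ (proj (-p.1)) ∈ A
    rw [hneg]
    exact p.2⟩
  have hι : Continuous ι := (continuous_subtype_val.neg).subtype_mk _
  have hιι : ∀ p, ι (ι p) = p := fun p => Subtype.ext (neg_neg _)
  have hψ : Continuous fun p : K => φ (proj p) := hφ.comp continuous_subtype_val
  refine ⟨Subtype.val '' connectedComponent x', isPreconnected_connectedComponent.image _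
    continuous_subtype_val.continuousOn, ⟨x', mem_connectedComponent, rfl⟩, ?_, ?_⟩
  · rintro _ ⟨a, -, rfl⟩
    exact a.2
  intro y hy
  obtain ⟨y', rfl⟩ : ∃ b, φ (proj b) = y := by
    obtain ⟨b, hb⟩ := Quotient.exists_rep (φ.symm y)
    exact ⟨b, by rw [proj, hb, φ.apply_symm_apply]⟩
  let b : K := ⟨y', hy⟩
  by_contra! hcon
  have h1 : b ∉ connectedComponent x' := fun h => hcon b ⟨b, h, rfl⟩ rfl
  have h2 : ι b ∉ connectedComponent x' := fun h => hcon (ι b) ⟨ι b, h, rfl⟩ (by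
    simp only [ι, hneg, b])
  rw [connectedComponent_eq_iInter_isClopen, Set.mem_iInter] at h1 h2
  push Not at h1 h2
  obtain ⟨⟨U, hU, hxU⟩, hbU⟩ := h1
  obtain ⟨⟨V, hV, hxV⟩, hbV⟩ := h2
  -- If the component of `x'` missed both preimages of `y`, this symmetric clopen set would contain
  -- `x'` but not `b`, and would descend to a separation of `A`.
  let W : Set K := (U ∩ V) ∪ ι ⁻¹' (U ∩ V)
  have hW : IsClopen W := (hU.inter hV).union ((hU.inter hV).preimage hι)
  have hxW : x' ∈ W := Or.inl ⟨hxU, hxV⟩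
  have hbW : b ∉ W := by
    rintro (h | h)
    · exact hbU h.1
    · exact hbV h.2
  have hWι : ∀ p, p ∈ W → ι p ∈ W := by
    rintro p (h | h)
    · exact Or.inr (by rwa [Set.mem_preimage, hιι])
    · exact Or.inl h
  have hsep : ∀ p q : K, p ∈ W → φ (proj p) = φ (proj q) → q ∈ W := by
    intro p q hp hpq
    rcases proj_eq_iff.1 (φ.injective hpq) with h | h
    · rwa [Subtype.ext h]
    · rw [show q = ι p from Subtype.ext h]
      exact hWι p hp
  have hc1 := (hW.isClosed.isCompact.image hψ).isClosed
  have hc2 := (hW.compl.isClosed.isCompact.image hψ).isClosed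
  obtain ⟨y, -, ⟨p, hp, hpy⟩, ⟨q, hq, hqy⟩⟩ :=
    isPreconnected_closed_iff.1 hA' _ _ hc1 hc2 (by
      intro y hy
      obtain ⟨p, rfl⟩ : ∃ p, φ (proj p) = y := by
        obtain ⟨p, hp⟩ := Quotient.exists_rep (φ.symm y)
        exact ⟨p, by rw [proj, hp, φ.apply_symm_apply]⟩
      by_cases hp : (⟨p, hy⟩ : K) ∈ W
      · exact Or.inl ⟨_, hp, rfl⟩
      · exact Or.inr ⟨_, hp, rfl⟩)
      ⟨_, hx, x', hxW, rfl⟩ ⟨_, hy, b, hbW, rfl⟩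
  exact hq (hsep p q hp (hpy.trans hqy.symm))

theorem norm_sub_le_of_isPreconnected {η : ℝ} {L : Set Torus} (hL : IsPreconnected L)
    (h : ∀ a ∈ L, ∀ b ∈ L, ‖a - b‖ ≤ η ∨ ‖a + b‖ ≤ η) {a b : Torus} (ha : a ∈ L) (hb : b ∈ L) :
    ‖a - b‖ ≤ 3 * η := by
  have hη : 0 ≤ η := (h a ha a ha).elim (norm_nonneg _).trans (norm_nonneg _).trans
  rcases h a ha b hb with hab | hab
  · linarith
  -- Connectedness forces some `c` to be close to both `a` and `-a`, so `2a` is small and `b`, close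
  -- to `-a`, is close to `a`.
  obtain ⟨c, -, hc1, hc2⟩ := isPreconnected_closed_iff.1 hL {c | ‖a - c‖ ≤ η} {c | ‖a + c‖ ≤ η}
    (isClosed_le (by fun_prop) (by fun_prop)) (isClosed_le (by fun_prop) (by fun_prop))
    (fun c hc => h a ha c hc) ⟨a, ha, by simpa using hη⟩ ⟨b, hb, hab⟩
  have e : a - b = (a - c) + (a + c) - (a + b) := by abel
  rw [e]
  have := norm_sub_le ((a - c) + (a + c)) (a + b)
  have := norm_add_le (a - c) (a + c)
  change ‖a - c‖ ≤ η at hc1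
  change ‖a + c‖ ≤ η at hc2
  linarith

theorem isCwNExpansive_two [CompactSpace X] : IsCwNExpansive 2 (mapOn φ) := by
  -- Connectedness costs a factor 3, and 3/24 is the expansivity constant 1/8.
  obtain ⟨δ, hδ, hclose⟩ := exists_norm_sub_or_add_le φ (η := 1 / 24) (by norm_num)
  refine ⟨δ, hδ, fun A hA B hB => ?_⟩
  have small : ∀ (A : Set X) (L : Set Torus), IsPreconnected L → (∀ a ∈ L, φ (proj a) ∈ A) →
      ∀ n : ℤ, (mapOn φ ^ n) '' A ∈ SmallContinua X δ → ∀ a ∈ L, ∀ b ∈ L,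
        ‖(torusMap ^ n) (a - b)‖ ≤ 1 / 8 := by
    intro A L hL hLA n hn a ha b hb
    rw [torusMap_zpow_sub]
    refine (norm_sub_le_of_isPreconnected (η := 1 / 24)
      (hL.image _ (torusMap ^ n).continuous.continuousOn) ?_ ⟨a, ha, rfl⟩ ⟨b, hb, rfl⟩).trans
      (by norm_num)
    rintro _ ⟨a, ha, rfl⟩ _ ⟨b, hb, rfl⟩
    refine hclose _ _ ?_
    rw [← mapOn_zpow_proj, ← mapOn_zpow_proj]
    exact (Metric.dist_le_diam_of_mem hn.1.isBounded ⟨_, hLA a ha, rfl⟩ ⟨_, hLA b hb, rfl⟩).trans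
      hn.2.2
  have hA0 := hA 0 le_rfl
  have hB0 := hB 0 le_rfl
  rw [zpow_zero, show ⇑(1 : X ≃ₜ X) = id from rfl, Set.image_id] at hA0 hB0
  rcases (A ∩ B).eq_empty_or_nonempty with hAB | ⟨_, hzA, hzB⟩
  · simp [hAB]
  rename_i z
  obtain ⟨x, rfl⟩ : ∃ x, φ (proj x) = z := by
    obtain ⟨x, hx⟩ := Quotient.exists_rep (φ.symm z)
    exact ⟨x, by rw [proj, hx, φ.apply_symm_apply]⟩
  obtain ⟨K, hK, hxK, hKA, hAK⟩ := exists_isPreconnected_lift φ hA0.1 hA0.2.1.2 hzA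
  obtain ⟨L, hL, hxL, hLB, hBL⟩ := exists_isPreconnected_lift φ hB0.1 hB0.2.1.2 hzB
  have key : ∀ a ∈ K, ∀ a' ∈ K, ∀ b ∈ L, ∀ b' ∈ L, (a - a' = b - b' ∨ a - a' = -(b - b')) →
      a = a' := by
    intro a ha a' ha' b hb b' hb' hab
    refine sub_eq_zero.1 (eq_zero_of_forall_norm_zpow_le fun n => ?_)
    rcases le_total 0 n with hn | hn
    · exact small A K hK hKA n (hA n hn) a ha a' ha'
    · have := small B L hL hLB n (hB n hn) b hb b' hb'
      rcases hab with hab | hab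
      · rwa [hab]
      · rwa [hab, torusMap_zpow_neg, norm_neg]
  have cases : ∀ y ∈ A ∩ B, y = φ (proj x) ∨ ∃ a ∈ K, -a ∈ L ∧ φ (proj a) = y := by
    rintro y ⟨hyA, hyB⟩
    obtain ⟨a, ha, rfl⟩ := hAK y hyA
    obtain ⟨b, hb, hab⟩ := hBL _ hyB
    rcases proj_eq_iff.1 (φ.injective hab.symm) with rfl | rfl
    · rw [key b ha x hxK b hb x hxL (Or.inl rfl)]
      exact Or.inl rfl
    · exact Or.inr ⟨a, ha, hb, rfl⟩
  by_cases hex : ∃ a ∈ K, -a ∈ L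
  · obtain ⟨a, ha, ha'⟩ := hex
    have hsub : A ∩ B ⊆ {φ (proj x), φ (proj a)} := by
      intro y hy
      rcases cases y hy with h | ⟨a', h1, h2, rfl⟩
      · exact Or.inl h
      · rw [key a' h1 a ha (-a') h2 (-a) ha' (Or.inr (by abel))]
        exact Or.inr rfl
    exact (Set.encard_le_encard hsub).trans (Set.encard_insert_le _ _ |>.trans (by
      rw [Set.encard_singleton]; norm_num))
  · have hsub : A ∩ B ⊆ {φ (proj x)} := by
      intro y hy
      rcases cases y hy with h | ⟨a', h1, h2, -⟩
      · exact h
      · exact absurd ⟨a', h1, h2⟩ hex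
    exact (Set.encard_le_encard hsub).trans (by rw [Set.encard_singleton]; norm_num)

end Lift

/-! ### Shadowing pseudo-orbits with prescribed sign changes -/

theorem exists_bounded_solution {μ M : ℝ} (hμ : 1 < μ) {c : ℤ → ℝ} (hc : ∀ n, |c n| ≤ M) :
    ∃ u : ℤ → ℝ, (∀ n, u (n + 1) = μ * u n + c n) ∧ ∀ n, |u n| ≤ M / (μ - 1) := by
  have hμ0 : 0 < μ := zero_lt_one.trans hμ
  have hν : μ⁻¹ < 1 := inv_lt_one_of_one_lt₀ hμ
  have hν0 : 0 ≤ μ⁻¹ := inv_nonneg.2 hμ0.le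
  have hgeo := (hasSum_geometric_of_lt_one hν0 hν).mul_left (μ⁻¹ * M)
  have hbound : ∀ (n : ℤ) (j : ℕ), ‖μ⁻¹ ^ (j + 1) * c (n + j)‖ ≤ μ⁻¹ * M * μ⁻¹ ^ j := by
    intro n j
    rw [norm_mul, Real.norm_of_nonneg (pow_nonneg hν0 _), Real.norm_eq_abs, pow_succ']
    nlinarith [mul_le_mul_of_nonneg_left (hc (n + j)) (mul_nonneg hν0 (pow_nonneg hν0 j))]
  have hsum : ∀ n : ℤ, Summable fun j : ℕ => μ⁻¹ ^ (j + 1) * c (n + j) := fun n =>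
    Summable.of_norm_bounded hgeo.summable (hbound n)
  -- The expanding recursion is solved backwards from infinity, summing the future forcing.
  refine ⟨fun n => -∑' j : ℕ, μ⁻¹ ^ (j + 1) * c (n + j), fun n => ?_, fun n => ?_⟩
  · beta_reduce
    rw [(hsum n).tsum_eq_zero_add, neg_add, mul_add, mul_neg, mul_neg, ← tsum_mul_left]
    have : ∀ j : ℕ, μ * (μ⁻¹ ^ (j + 1 + 1) * c (n + ((j + 1 : ℕ) : ℤ))) =
        μ⁻¹ ^ (j + 1) * c (n + 1 + j) := by
      intro j
      rw [pow_succ _ (j + 1), show n + ((j + 1 : ℕ) : ℤ) = n + 1 + j by push_cast; ring]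
      field_simp
    simp only [this]
    rw [zero_add, pow_one, Nat.cast_zero, add_zero, mul_inv_cancel_left₀ hμ0.ne']
    ring
  · rw [abs_neg, ← Real.norm_eq_abs]
    refine (tsum_of_norm_bounded hgeo (hbound n)).trans_eq ?_
    have : μ - 1 ≠ 0 := by linarith
    have : 1 - μ⁻¹ ≠ 0 := by linarith
    field_simp

open Real in
theorem exists_bounded_torus_solution {η : ℝ} {c : ℤ → ℝ} (hc : ∀ n, |c n| ≤ η) :
    ∃ x y : ℤ → ℝ, (∀ n, x (n + 1) = 2 * x n + y n + c n) ∧ (∀ n, y (n + 1) = x n + y n) ∧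
      (∀ n, |x n| ≤ η) ∧ ∀ n, |y n| ≤ η := by
  have hb : goldenRatio * η / (goldenRatio ^ 2 - 1) = η := by
    rw [goldenRatio_sq, add_sub_cancel_right, mul_div_cancel_left₀ _ goldenRatio_ne_zero]
  have hcφ : ∀ n, |goldenRatio * c n| ≤ goldenRatio * η := fun n => by
    rw [abs_mul, abs_of_pos goldenRatio_pos]
    exact mul_le_mul_of_nonneg_left (hc n) goldenRatio_pos.le
  -- Eigencoordinates: `u n` is the unstable one, and `v (-n)` the stable one, which expands when
  -- time is reversed.
  obtain ⟨u, hu, hu'⟩ := exists_bounded_solution one_lt_goldenRatio_sq hcφ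
  obtain ⟨v, hv, hv'⟩ := exists_bounded_solution one_lt_goldenRatio_sq
    (c := fun n => goldenRatio * c (-n - 1)) (fun n => hcφ _)
  rw [hb] at hu' hv'
  have hs : ∀ n, v (-(n + 1)) = goldenConj ^ 2 * v (-n) + goldenConj * c n := by
    intro n
    have h := hv (-(n + 1))
    rw [show -(n + 1) + 1 = -n by ring, show -(-(n + 1)) - 1 = n by ring] at h
    have e : goldenConj * goldenRatio = -1 := goldenConj_mul_goldenRatio
    rw [h]
    linear_combination (-(goldenConj * goldenRatio - 1) * v (-(n + 1)) - goldenConj * c n) * e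
  have h5 : goldenRatio - goldenConj = √5 := goldenRatio_sub_goldenConj
  have h5' : 2 ≤ √5 := Real.le_sqrt_of_sq_le (by norm_num)
  have h5ne : √5 ≠ 0 := by positivity
  have hs5 : √5 ^ 2 = 5 := Real.sq_sqrt (by norm_num)
  have hη : 0 ≤ η := (abs_nonneg _).trans (hc 0)
  have hψ := goldenConj_neg
  refine ⟨fun n => (u n - v (-n)) / √5, fun n => (goldenRatio * v (-n) - goldenConj * u n) / √5,
    fun n => ?_, fun n => ?_, fun n => ?_, fun n => ?_⟩
  · simp only [hu, hs]
    field_simp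
    rw [← h5]
    linear_combination u n * goldenRatio_sq - v (-n) * goldenConj_sq +
      (u n - v (-n)) * goldenRatio_add_goldenConj + 3 / 4 * (u n - v (-n)) * hs5
  · simp only [hu, hs]
    field_simp
    linear_combination (goldenConj * v (-n) - goldenRatio * u n) * goldenRatio_mul_goldenConj +
      7 / 8 * (√5 * (v (-n) + u n) + (u n - v (-n))) * hs5
  · rw [abs_div, abs_of_pos (by positivity : 0 < √5), div_le_iff₀ (by positivity)]
    nlinarith [abs_sub (u n) (v (-n)), hu' n, hv' (-n)]
  · rw [abs_div, abs_of_pos (by positivity : 0 < √5), div_le_iff₀ (by positivity), ← h5]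
    refine (abs_sub _ _).trans ?_
    rw [abs_mul, abs_mul, abs_of_pos goldenRatio_pos, abs_of_neg hψ]
    nlinarith [mul_le_mul_of_nonneg_left (hu' n) (neg_nonneg.2 hψ.le),
      mul_le_mul_of_nonneg_left (hv' (-n)) goldenRatio_pos.le]

/-- The map permutes the finite set of `m`-torsion points. -/
theorem exists_zpow_apply_eq_self {m : ℕ} (hm : 0 < m) {p : Torus} (hp : m • p = 0) :
    ∃ k : ℤ, 0 < k ∧ (torusMap ^ k) p = p := by
  let S : Set Torus := {q | m • q = 0}
  have hS : S.Finite := by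
    refine ((AddCircle.finite_torsion (1 : ℝ) hm).prod (AddCircle.finite_torsion (1 : ℝ) hm)).subset
      fun q hq => ?_
    exact ⟨congrArg Prod.fst (show m • q = 0 from hq), congrArg Prod.snd (show m • q = 0 from hq)⟩
  have := hS.to_subtype
  have hf : ∀ q ∈ S, torusMap q ∈ S := by
    intro q hq
    have h : ∀ n : ℕ, torusMap (n • q) = n • torusMap q := fun n =>
      map_nsmul (AddMonoidHom.mk' torusMap torusMap_add) n q
    change m • torusMap q = 0
    rw [← h, show m • q = 0 from hq]
    exact Prod.ext (by simp [torusMap]) (by simp [torusMap])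
  let F : S → S := fun q => ⟨torusMap q, hf q q.2⟩
  have hF : Function.Injective F := fun a b h =>
    Subtype.ext (torusMap.injective (congrArg Subtype.val h))
  obtain ⟨k, hk, hk'⟩ := hF.mem_periodicPts ⟨p, hp⟩
  refine ⟨k, by exact_mod_cast hk, ?_⟩
  have hit : ∀ (n : ℕ) (q : S), ((F^[n] q : S) : Torus) = (torusMap ^ (n : ℤ)) q := by
    intro n q
    induction n with
    | zero => rfl
    | succ n ih =>
      rw [Function.iterate_succ_apply', Nat.cast_succ, zpow_add_one_apply, ← ih]
  rw [← hit k ⟨p, hp⟩]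
  exact congrArg Subtype.val hk'

/-- The sign prescribed by `σ` at the integer `j`; it is `1` for `j ≤ 0`. -/
def signAt (σ : ℕ → Bool) (j : ℤ) : ℤ :=
  if 0 < j ∧ σ (j - 1).toNat then -1 else 1

theorem signAt_eq_or (σ : ℕ → Bool) (j : ℤ) : signAt σ j = 1 ∨ signAt σ j = -1 := by
  unfold signAt
  split_ifs <;> simp

theorem signAt_zero (σ : ℕ → Bool) : signAt σ 0 = 1 := by simp [signAt]

theorem signAt_injective : Function.Injective signAt := by
  intro σ τ h
  ext i
  have := congrFun h (i + 1)
  have hi : (0 : ℤ) < i + 1 := by positivity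
  simp only [signAt, hi, true_and, add_sub_cancel_right, Int.toNat_natCast] at this
  cases hσ : σ i <;> cases hτ : τ i <;> simp_all

theorem zpow_mul_add_apply {p : Torus} {k : ℤ} (hp : (torusMap ^ k) p = p) (j r : ℤ) :
    (torusMap ^ (k * j + r)) p = (torusMap ^ r) p := by
  have h : (torusMap ^ (k * j)) p = p := by
    rw [zpow_mul]
    exact (eq_zpow_apply (f := torusMap ^ k) (x := fun _ => p) (fun _ => hp.symm) j).symm
  rw [add_comm, zpow_add]
  exact congrArg (torusMap ^ r) h

/-- Orbits that follow the orbit of `p = (1/m, 0)` up to sign, the sign being allowed to change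
whenever the orbit returns to `p`. -/
theorem exists_orbit_near_signed_orbit {m : ℕ} (hm : 0 < m) {k : ℤ} (hk : 0 < k)
    {p : Torus} (hpdef : p = ((((m : ℝ)⁻¹ : ℝ) : UnitAddCircle), (0 : UnitAddCircle)))
    (hp : (torusMap ^ k) p = p) (s : ℤ → ℤ)
    (hs : ∀ j, s j = 1 ∨ s j = -1) : ∃ q : Torus, ∀ n : ℤ,
      ‖(torusMap ^ n) q - s (n / k) • (torusMap ^ n) p‖ ≤ 2 / m := by
  have hm' : (0 : ℝ) < m := by exact_mod_cast hm
  obtain ⟨x, y, hx, hy, hx', hy'⟩ := exists_bounded_torus_solution (η := 2 / m)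
    -- A sign change is a jump by ±2p, which lies in the first coordinate only and has size 2/m.
    (c := fun n => ((s (n / k) - s ((n + 1) / k) : ℤ) : ℝ) * (m : ℝ)⁻¹) (fun n => by
      rw [abs_mul, abs_of_pos (inv_pos.2 hm'), div_eq_mul_inv]
      refine mul_le_mul_of_nonneg_right ?_ (inv_pos.2 hm').le
      rcases hs (n / k) with h1 | h1 <;> rcases hs ((n + 1) / k) with h2 | h2 <;>
        rw [h1, h2] <;> norm_num)
  let e : ℤ → Torus := fun n => ((x n : UnitAddCircle), (y n : UnitAddCircle))
  have he : ∀ n, e (n + 1) = torusMap (e n) + (s (n / k) - s ((n + 1) / k)) • p := by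
    intro n
    refine Prod.ext ?_ ?_
    · simp only [e, hx, torusMap, hpdef]
      simp only [AddCircle.coe_add, two_mul, two_nsmul, ← zsmul_eq_mul, AddCircle.coe_zsmul]
      rfl
    · simp only [e, hy, torusMap, hpdef]
      simp
  -- The quotients can differ only when `k` divides `n + 1`, that is, at a return to `p`.
  have hdiv : ∀ n : ℤ, s (n / k) ≠ s ((n + 1) / k) → (torusMap ^ (n + 1)) p = p := by
    intro n hn
    obtain ⟨j, hj⟩ : k ∣ n + 1 := by
      by_contra hnd
      refine hn (congrArg s ?_)
      have hmod : (n + 1) % k ≠ 0 := fun h => hnd (Int.dvd_of_emod_eq_zero h)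
      have h1 := Int.emod_nonneg (n + 1) hk.ne'
      have h2 := Int.emod_lt_of_pos (n + 1) hk
      have h3 := Int.mul_ediv_add_emod (n + 1) k
      rw [Int.ediv_eq_iff_of_pos hk]
      constructor <;> nlinarith [lt_of_le_of_ne h1 hmod.symm]
    rw [hj, ← add_zero (k * j), zpow_mul_add_apply hp]
    rfl
  have horb := eq_zpow_apply (f := torusMap)
    (x := fun n => s (n / k) • (torusMap ^ n) p + e n) (fun n => by
      have hz : torusMap (s (n / k) • (torusMap ^ n) p) =
          s (n / k) • (torusMap ^ (n + 1)) p := by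
        rw [zpow_add_one_apply]
        exact map_zsmul (AddMonoidHom.mk' torusMap torusMap_add) _ _
      rw [torusMap_add, hz, he]
      by_cases h : s (n / k) = s ((n + 1) / k)
      · rw [h, sub_self, zero_zsmul, add_zero]
      · rw [hdiv n h, sub_zsmul]
        abel)
  refine ⟨s (0 / k) • (torusMap ^ (0 : ℤ)) p + e 0, fun n => ?_⟩
  rw [← horb, add_sub_cancel_left]
  exact max_le ((norm_coe_le_abs _).trans (hx' n)) ((norm_coe_le_abs _).trans (hy' n))

theorem exists_injective_shadowing {η : ℝ} (hη : 0 < η) : ∃ (p : Torus) (q : (ℕ → Bool) → Torus),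
    Function.Injective (fun σ => proj (q σ)) ∧ ∀ (σ : ℕ → Bool) (n : ℤ),
      ‖(torusMap ^ n) (q σ) - (torusMap ^ n) p‖ ≤ η ∨
        ‖(torusMap ^ n) (q σ) + (torusMap ^ n) p‖ ≤ η := by
  obtain ⟨m, hm⟩ := exists_nat_gt (max 32 (2 / η))
  have hm32 : (32 : ℝ) < m := (le_max_left _ _).trans_lt hm
  have hm0 : 0 < m := by exact_mod_cast (by norm_num : (0 : ℝ) < 32).trans hm32
  have hmη : 2 / (m : ℝ) ≤ η := by
    rw [div_le_comm₀ (by linarith) hη]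
    exact ((le_max_right _ _).trans_lt hm).le
  let p : Torus := (((m : ℝ)⁻¹ : ℝ), 0)
  have hmp : m • p = 0 := by
    refine Prod.ext ?_ (smul_zero m)
    change m • (((m : ℝ)⁻¹ : ℝ) : UnitAddCircle) = 0
    rw [← AddCircle.coe_nsmul, nsmul_eq_mul, mul_inv_cancel₀ (by linarith)]
    exact AddCircle.coe_period 1
  obtain ⟨k, hk, hkp⟩ := exists_zpow_apply_eq_self hm0 hmp
  choose q hq using fun σ => exists_orbit_near_signed_orbit hm0 hk (p := p) rfl hkp
    (signAt σ) (signAt_eq_or σ)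
  refine ⟨p, q, fun σ τ hστ => ?_, fun σ n => ?_⟩
  · have hp2 : p + p ≠ 0 := by
      intro h
      have h1 := congrArg Prod.fst h
      change (((m : ℝ)⁻¹ : ℝ) : UnitAddCircle) + (((m : ℝ)⁻¹ : ℝ) : UnitAddCircle) = (0 : ℝ) at h1
      have hinv : (m : ℝ)⁻¹ < 32⁻¹ := inv_strictAnti₀ (by norm_num) hm32
      have hinv0 : 0 < (m : ℝ)⁻¹ := by positivity
      rw [← AddCircle.coe_add] at h1
      have := eq_of_coe_eq_of_abs_sub_lt_one h1 (by
        rw [abs_lt]; constructor <;> linarith)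
      linarith
    -- At this time, and by periodicity once in each block of length `k`, the iterates of `p` and
    -- `-p` are over 1/8 apart. As 2/m + 2/m < 1/8, no orbit can be near both, so the sign is
    -- readable there.
    obtain ⟨r, hr⟩ : ∃ r : ℤ, 1 / 8 < ‖(torusMap ^ r) (p + p)‖ := by
      by_contra! h
      exact hp2 (eq_zero_of_forall_norm_zpow_le h)
    obtain ⟨θ, hθ, hqθ⟩ : ∃ θ : ℤ, (θ = 1 ∨ θ = -1) ∧ q τ = θ • q σ := by
      rcases proj_eq_iff.1 hστ with h | h
      · exact ⟨1, Or.inl rfl, by rw [h, one_zsmul]⟩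
      · exact ⟨-1, Or.inr rfl, by rw [h, neg_zsmul, one_zsmul]⟩
    have hn : ∀ n : ℤ, 1 / 8 < ‖(torusMap ^ n) (p + p)‖ →
        signAt τ (n / k) = θ * signAt σ (n / k) := by
      intro n hn
      have h1 := hq σ n
      have h2 := hq τ n
      have hlin : (torusMap ^ n) (θ • q σ) = θ • (torusMap ^ n) (q σ) := by
        rcases hθ with rfl | rfl
        · rw [one_zsmul, one_zsmul]
        · rw [neg_zsmul, neg_zsmul, one_zsmul, one_zsmul, torusMap_zpow_neg]
      have h3 : ‖(torusMap ^ n) (q τ) - (θ * signAt σ (n / k)) • (torusMap ^ n) p‖ ≤ 2 / m := by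
        rw [hqθ, hlin, mul_zsmul, ← zsmul_sub]
        rcases hθ with rfl | rfl
        · rwa [one_zsmul]
        · rwa [neg_zsmul, one_zsmul, norm_neg]
      by_contra hne
      have h4 : ‖(torusMap ^ n) (p + p)‖ ≤ 2 / m + 2 / m := by
        have hsgn : θ * signAt σ (n / k) = 1 ∧ signAt τ (n / k) = -1 ∨
            θ * signAt σ (n / k) = -1 ∧ signAt τ (n / k) = 1 := by
          rcases hθ with h | h <;> rcases signAt_eq_or σ (n / k) with h' | h' <;>
            rcases signAt_eq_or τ (n / k) with h'' | h'' <;> simp_all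
        rw [torusMap_zpow_add]
        generalize (torusMap ^ n) (q τ) = z at *
        generalize (torusMap ^ n) p = w at *
        rcases hsgn with ⟨ha, hb⟩ | ⟨ha, hb⟩
        · rw [hb, neg_zsmul, one_zsmul] at h2
          rw [ha, one_zsmul] at h3
          have e : w + w = (z - -w) - (z - w) := by abel
          rw [e]
          exact (norm_sub_le _ _).trans (add_le_add h2 h3)
        · rw [hb, one_zsmul] at h2
          rw [ha, neg_zsmul, one_zsmul] at h3
          have e : w + w = (z - -w) - (z - w) := by abel
          rw [e]
          exact (norm_sub_le _ _).trans (add_le_add h3 h2)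
      have h5 : 2 / (m : ℝ) < 1 / 16 := by
        rw [div_lt_div_iff₀ (by linarith) (by norm_num)]; linarith
      linarith
    have hall : ∀ i : ℤ, signAt τ i = θ * signAt σ i := by
      intro i
      have h := hn (k * (i - r / k) + r) (by
        rw [torusMap_zpow_add, zpow_mul_add_apply hkp, ← torusMap_zpow_add]
        exact hr)
      rwa [add_comm, Int.add_mul_ediv_left _ _ hk.ne', add_sub_cancel] at h
    -- All sign sequences equal 1 at time 0, which removes the global sign ambiguity.
    have hθ1 : θ = 1 := by simpa [signAt_zero] using (hall 0).symm
    refine signAt_injective (funext fun i => ?_)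
    rw [hall, hθ1, one_mul]
  · rcases signAt_eq_or σ (n / k) with h | h
    · left
      have := hq σ n
      rw [h, one_zsmul] at this
      exact this.trans hmη
    · right
      have := hq σ n
      rw [h, neg_zsmul, one_zsmul, sub_neg_eq_add] at this
      exact this.trans hmη

/-! ### Small Cantor sets -/

theorem IsCantorSet.encard_eq_top {X : Type*} [TopologicalSpace X] {C : Set X}
    (hC : IsCantorSet C) : C.encard = ⊤ := by
  obtain ⟨e⟩ := hC
  have : Infinite C :=
    Infinite.of_injective _ (e.trans cantorSetHomeomorphNatToBool).symm.injective
  exact Set.encard_eq_top (Set.infinite_coe_iff.1 this)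

section Cantor

variable {X : Type*} [MetricSpace X] [CompactSpace X] (φ : TorusQuotient ≃ₜ X)

/-- This is the perfect set theorem: an uncountable closed set contains an injective continuous
image of `ℕ → Bool`, which by compactness is an embedding. -/
theorem exists_isCantorSet_subset {C : Set X} (hC : IsClosed C) (hC' : ¬ C.Countable) :
    ∃ D ⊆ C, IsCantorSet D := by
  obtain ⟨f, hfC, hf, hinj⟩ := hC.exists_nat_bool_injection_of_not_countable hC'
  exact ⟨Set.range f, hfC, ⟨((hf.isClosedEmbedding hinj).isEmbedding.toHomeomorph.symm).trans
    cantorSetHomeomorphNatToBool.symm⟩⟩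

theorem exists_small_isCantorSet {ε : ℝ} (hε : 0 < ε) : ∃ C : Set X, IsCantorSet C ∧
    ∀ n : ℤ, Metric.diam ((mapOn φ ^ n) '' C) ≤ ε := by
  have hφ : Continuous fun p => φ (proj p) := φ.continuous.comp continuous_proj
  obtain ⟨η, hη, hclose⟩ := Metric.uniformContinuous_iff.1
    (CompactSpace.uniformContinuous_of_continuous hφ) (ε / 2) (by positivity)
  obtain ⟨p, q, hq, hqp⟩ := exists_injective_shadowing (half_pos hη)
  let K : Set X := {y | ∀ n : ℤ, dist ((mapOn φ ^ n) y) ((mapOn φ ^ n) (φ (proj p))) ≤ ε / 2}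
  have hK : IsClosed K := by
    have hKeq : K = ⋂ n : ℤ,
        {y | dist ((mapOn φ ^ n) y) ((mapOn φ ^ n) (φ (proj p))) ≤ ε / 2} := by
      ext y
      rw [Set.mem_iInter]
      rfl
    rw [hKeq]
    exact isClosed_iInter fun n : ℤ =>
      isClosed_le ((mapOn φ ^ n).continuous.dist continuous_const) continuous_const
  have hqK : ∀ σ, φ (proj (q σ)) ∈ K := by
    intro σ n
    rw [mapOn_zpow_proj, mapOn_zpow_proj]
    rcases hqp σ n with h | h
    · exact (hclose (by rw [dist_eq_norm]; linarith)).le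
    · rw [show proj ((torusMap ^ n) p) = proj (-(torusMap ^ n) p) from
        proj_eq_iff.2 (Or.inr rfl)]
      exact (hclose (by rw [dist_eq_norm, sub_neg_eq_add]; linarith)).le
  have hunc : ¬ K.Countable := by
    intro hcount
    have hcard : Cardinal.mk (ℕ → Bool) = 2 ^ Cardinal.aleph0 := by simp
    have := hcount.to_subtype
    have : Countable (ℕ → Bool) := Function.Injective.countable (β := K)
      (f := fun σ => ⟨φ (proj (q σ)), hqK σ⟩)
      fun σ τ h => hq (φ.injective (congrArg Subtype.val h))
    exact (Cardinal.cantor Cardinal.aleph0).not_ge (hcard ▸ Cardinal.mk_le_aleph0)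
  obtain ⟨D, hDK, hD⟩ := exists_isCantorSet_subset hK hunc
  refine ⟨D, hD, fun n => Metric.diam_le_of_forall_dist_le hε.le ?_⟩
  rintro _ ⟨a, ha, rfl⟩ _ ⟨b, hb, rfl⟩
  have h1 := hDK ha n
  have h2 := hDK hb n
  have := dist_triangle_right ((mapOn φ ^ n) a) ((mapOn φ ^ n) b) ((mapOn φ ^ n) (φ (proj p)))
  linarith

theorem not_isNExpansive (N : ℕ) : ¬ IsNExpansive N (mapOn φ) := by
  rintro ⟨δ, hδ, h⟩
  obtain ⟨C, hC, hC'⟩ := exists_small_isCantorSet φ hδ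
  have := h C hC'
  rw [hC.encard_eq_top] at this
  exact absurd this (by simp)

end Cantor

end CwExpansive

/-- The quotient `T²/(p ∼ -p)` is a two-dimensional sphere. For every (automatically compact)
metric space `X` identified with it by a homeomorphism `φ`, that is, for every compatible metric on
the sphere, the map induced by `(x, y) ↦ (2x + y, x + y)` has the stated properties. -/
theorem mainTheorem12 :
    Nonempty (CwExpansive.TorusQuotient ≃ₜ Metric.sphere (0 : EuclideanSpace ℝ (Fin 3)) 1) ∧
    ∀ (X : Type*) [MetricSpace X] [CompactSpace X] (φ : CwExpansive.TorusQuotient ≃ₜ X),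
      (∀ ε : ℝ, 0 < ε → ∃ C : Set X, CwExpansive.IsCantorSet C ∧
        ∀ n : ℤ, Metric.diam ((CwExpansive.mapOn φ ^ n) '' C) ≤ ε) ∧
      (∀ N : ℕ, 1 ≤ N → ¬ CwExpansive.IsNExpansive N (CwExpansive.mapOn φ)) ∧
      CwExpansive.IsCwNExpansive 2 (CwExpansive.mapOn φ) := by
  refine ⟨CwExpansive.nonempty_torusQuotient_homeomorph_sphere, fun X _ _ φ => ⟨?_, ?_, ?_⟩⟩
  · exact fun ε hε => CwExpansive.exists_small_isCantorSet φ hε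
  · exact fun N _ => CwExpansive.not_isNExpansive φ N
  · exact CwExpansive.isCwNExpansive_two φ
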